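/- Let $G$ be a second countable locally compact Hausdorff group, let $H,K\subseteq G$ be closed subgroups, and let $\pi$ and $\gamma$ be strongly continuous representations of $H$ and $K$ by surjective linear isometries on complex Banach spaces $\mathcal H(\pi)$ and $\mathcal H(\gamma)$. Let $\gamma^*(k)=\gamma(k^{-1})^*$ be the contragredient of $\gamma$, acting on the dual space $\mathcal H(\gamma^*)=\mathcal H(\gamma)^*$. Write $G/H$ for the space of right cosets $Hx$. Let $\rho_H>0$ be a continuous function on $G$ with $\rho_H(hx)=\frac{\Delta_H(h)}{\Delta_G(h)}\rho_H(x)$ for $h\in H$, $x\in G$, where the modular functions $\Delta$ are normalized by $\nu(gA)=\Delta(g)\nu(A)$ for right Haar measures $\nu$. Put $\lambda_H(x,y)=\rho_H(xy)/\rho_H(x)$, which depends only on $Hx$ and $y$, and let $\mu_H$ be a nonzero Borel measure on $G/H$, finite on compact sets, such that for every $y\in G$ the function $\lambda_H(\cdot,y)$ is a Radon–Nikodym derivative of $E\mapsto\mu_H(Ey)$ with respect to $\mu_H$. Choose $\rho_K,\lambda_K,\mu_K$ in the same way for $K$. For $1\le r<\infty$ and an isometric representation $\tau$ of $H$ on a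 Banach space $\mathcal H(\tau)$, let $L_r(\tau)$ be the space of functions $f:G\to\mathcal H(\tau)$ such that $x\mapsto\langle f(x),v\rangle$ is Borel for all $v\in\mathcal H(\tau)^*$, the range of $f$ is separable (automatic when $\mathcal H(\tau)$ is separable), $f(hx)=\tau(h)f(x)$ for $h\in H$, $x\in G$, and $\|f\|_r=\bigl(\int_{G/H}\|f(x)\|^r\,d\mu_H(Hx)\bigr)^{1/r}<\infty$, where functions that are equal almost everywhere are identified. The induced representation of $G$ on $L_r(\tau)$ is $(U_r^\tau(y)f)(x)=\lambda_H(x,y)^{1/r}f(xy)$. The same definitions apply with $K$ in place of $H$. Let $1<p,q'<\infty$ and $1/q+1/q'=1$. Let $L_p(\pi)\otimes^\sigma L_{q'}(\gamma^*)$ be the (completed) projective tensor product, let $L$ be the closed linear span in it of all elements $$U_p^\pi(s)f\otimes g-f\otimes (U_q^\gamma(s))^*g,\qquad s\in G,\ f\in L_p(\pi),\ g\in L_{q'}(\gamma^*),$$ where $(U_q^\gamma(s))^*=U_{q'}^{\gamma^*}(s^{-1})$ is the adjoint of $U_q^\gamma(s)$ under the pairing $\langle k,g\rangle=\int_{G/K}\langle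 k(x),g(x)\rangle\,d\mu_K$ of $L_q(\gamma)$ with $L_{q'}(\gamma^*)$, and put $L_p(\pi)\otimes_G^\sigma L_{q'}(\gamma^*)=\bigl(L_p(\pi)\otimes^\sigma L_{q'}(\gamma^*)\bigr)/L$. Theorem. Suppose that $1/p+1/q'<1$ and that for every compact set $F\subseteq G$ there is an $x\in G$ with $HFx\cap HF=\emptyset$ and $KFx\cap KF=\emptyset$. Then $$L_p(\pi)\otimes_G^\sigma L_{q'}(\gamma^*)=\{0\}.$$ -/

import Mathlib

open MeasureTheory TopologicalSpace
open scoped TensorProduct Pointwise NNReal ENNReal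

namespace InducedTensor

/-! ### Right cosets, rho-functions, quasi-invariant measures -/

section Cosets

variable {G : Type*} [Group G]

/-- The space of right cosets `Hx`, with the quotient topology and the quotient measurable structure
(a set of cosets is measurable iff its preimage in `G` is; for a closed subgroup of a second
countable locally compact group these are exactly the Borel sets). -/
abbrev RightCosets (H : Subgroup G) : Type _ := Quotient (QuotientGroup.rightRel H)

/-- The canonical map `x ↦ Hx`. -/
def proj (H : Subgroup G) (x : G) : RightCosets H := Quotient.mk (QuotientGroup.rightRel H) x

theorem proj_mul (H : Subgroup G) (h : H) (x : G) : proj H ((h : G) * x) = proj H x := by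
  refine Quotient.sound (s := QuotientGroup.rightRel H) ?_
  change (QuotientGroup.rightRel H) _ _
  rw [QuotientGroup.rightRel_apply]
  simp

theorem exists_of_rel {H : Subgroup G} {a b : G} (hab : (QuotientGroup.rightRel H) a b) :
    ∃ h : H, b = (h : G) * a := by
  rw [QuotientGroup.rightRel_apply] at hab
  exact ⟨⟨_, hab⟩, by simp⟩

theorem exists_out (H : Subgroup G) (x : G) :
    ∃ h : H, (proj H x).out = (h : G) * x := by
  apply exists_of_rel
  exact (QuotientGroup.rightRel H).symm' (Quotient.mk_out (s := QuotientGroup.rightRel H) x)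

/-- Right translation `Hx ↦ Hxy` on the coset space. -/
def translate (H : Subgroup G) (y : G) : RightCosets H → RightCosets H :=
  Quotient.lift (fun x => proj H (x * y)) (by
    intro a b hab
    obtain ⟨h, rfl⟩ := exists_of_rel hab
    rw [mul_assoc, proj_mul])

@[simp] theorem translate_proj (H : Subgroup G) (x y : G) :
    translate H y (proj H x) = proj H (x * y) := rfl

variable [TopologicalSpace G] [IsTopologicalGroup G] [LocallyCompactSpace G]

/-- The modular function of a locally compact group: `m (A g⁻¹) = Δ g * m A` for a left Haar
measure `m`; equivalently `ν (g A) = Δ g * ν A` for a right Haar measure `ν`. -/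
noncomputable def modular (G : Type*) [Group G] [TopologicalSpace G] [IsTopologicalGroup G]
    [LocallyCompactSpace G] (g : G) : ℝ :=
  ((Measure.modularCharacterFun g : ℝ≥0) : ℝ)

/-- The modular function of a closed subgroup of a locally compact group. -/
noncomputable def modularSub (H : Subgroup G) (hH : IsClosed (H : Set G)) (h : H) : ℝ :=
  haveI : LocallyCompactSpace H := hH.isClosedEmbedding_subtypeVal.locallyCompactSpace
  modular H h

/-- A strictly positive continuous function `ρ` on `G` with
`ρ (h x) = (Δ_H h / Δ_G h) * ρ x` for `h ∈ H`. -/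
structure RhoFunction (H : Subgroup G) (hH : IsClosed (H : Set G)) where
  rho : G → ℝ
  continuous_rho : Continuous rho
  rho_pos : ∀ x, 0 < rho x
  rho_mul : ∀ (h : H) (x : G), rho ((h : G) * x) = modularSub H hH h / modular G (h : G) * rho x

variable {H : Subgroup G} {hH : IsClosed (H : Set G)}

/-- The function `λ (Hs, y) = ρ (s y) / ρ s` on `(G/H) × G`. -/
noncomputable def RhoFunction.lam (ρ : RhoFunction H hH) (z : RightCosets H) (y : G) : ℝ :=
  Quotient.lift (fun s => ρ.rho (s * y) / ρ.rho s) (by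
    intro a b hab
    obtain ⟨h, rfl⟩ := exists_of_rel hab
    have h1 := ρ.rho_pos a
    have h2 := ρ.rho_pos ((h : G) * a)
    have h3 := ρ.rho_mul h a
    have h4 : modularSub H hH h / modular G (h : G) ≠ 0 := by
      intro h0
      rw [h3, h0, zero_mul] at h2
      exact lt_irrefl _ h2
    change ρ.rho (a * y) / ρ.rho a = ρ.rho ((h : G) * a * y) / ρ.rho ((h : G) * a)
    rw [mul_assoc, ρ.rho_mul, ρ.rho_mul, mul_div_mul_left _ _ h4]) z

@[simp] theorem RhoFunction.lam_proj (ρ : RhoFunction H hH) (s y : G) :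
    ρ.lam (proj H s) y = ρ.rho (s * y) / ρ.rho s := rfl

theorem RhoFunction.lam_pos (ρ : RhoFunction H hH) (s y : G) : 0 < ρ.lam (proj H s) y :=
  div_pos (ρ.rho_pos _) (ρ.rho_pos _)

variable [MeasurableSpace G]

/-- A quasi-invariant measure `μ` on the space of right cosets belonging to a continuous
rho-function: for every `y`, `λ (·, y)` is a Radon-Nikodym derivative of the translated measure
`E ↦ μ (E y)` with respect to `μ`. -/
structure QuasiInvariantMeasure (H : Subgroup G) (hH : IsClosed (H : Set G))
    extends RhoFunction H hH where
  μ : Measure (RightCosets H)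
  ne_zero : μ ≠ 0
  lt_top_of_isCompact : ∀ C : Set (RightCosets H), IsCompact C → μ C < ∞
  map_translate : ∀ y : G, μ.map (translate H y⁻¹) =
    μ.withDensity (fun z => ENNReal.ofReal (toRhoFunction.lam z y))

end Cosets

/-! ### Representations by isometries and their duals -/

section Dual

variable {S : Type*} [Group S] {W : Type*} [NormedAddCommGroup W] [NormedSpace ℂ W]

/-- The adjoint `φ ↦ φ ∘ T` of a surjective linear isometry. -/
noncomputable def adjointIso (T : W ≃ₗᵢ[ℂ] W) : StrongDual ℂ W ≃ₗᵢ[ℂ] StrongDual ℂ W where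
  toFun φ := φ.comp (T : W →L[ℂ] W)
  invFun φ := φ.comp (T.symm : W →L[ℂ] W)
  map_add' φ ψ := by ext; simp
  map_smul' c φ := by ext; simp
  left_inv φ := by ext; simp
  right_inv φ := by ext; simp
  norm_map' φ := ContinuousLinearMap.opNorm_comp_linearIsometryEquiv φ T

@[simp] theorem adjointIso_apply (T : W ≃ₗᵢ[ℂ] W) (φ : StrongDual ℂ W) (w : W) :
    adjointIso T φ w = φ (T w) := rfl

/-- The contragredient representation `γ* (s) = (γ (s⁻¹))*` on the dual space. -/
noncomputable def dualRep (γ : S →* (W ≃ₗᵢ[ℂ] W)) :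
    S →* (StrongDual ℂ W ≃ₗᵢ[ℂ] StrongDual ℂ W) where
  toFun s := adjointIso (γ s⁻¹)
  map_one' := by ext φ w; simp
  map_mul' s t := by ext φ w; simp

end Dual

/-! ### The spaces `L_p(π)` and the induced representation -/

section Lp

variable {G : Type*} [Group G] [MeasurableSpace G]
  {V : Type*} [NormedAddCommGroup V] [NormedSpace ℂ V]

/-- The function `Hx ↦ ‖f x‖` on right cosets. It is used only for `f` satisfying the covariance
condition, for which `‖f x‖` depends only on `Hx`. -/
noncomputable def cosetNorm (H : Subgroup G) (f : G → V) (z : RightCosets H) : ℝ≥0∞ :=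
  ‖f z.out‖ₑ

theorem cosetNorm_proj {H : Subgroup G} (π : H →* (V ≃ₗᵢ[ℂ] V)) {f : G → V}
    (hf : ∀ (h : H) (x : G), f ((h : G) * x) = π h (f x)) (x : G) :
    cosetNorm H f (proj H x) = ‖f x‖ₑ := by
  obtain ⟨h, hh⟩ := exists_out H x
  rw [cosetNorm, hh, hf, LinearIsometryEquiv.enorm_map]

/-- Weakly measurable functions with separable range have measurable norm. -/
theorem measurable_enorm_of_weak {f : G → V}
    (hw : ∀ φ : StrongDual ℂ V, Measurable fun x => φ (f x)) (hs : IsSeparable (Set.range f)) :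
    Measurable fun x => ‖f x‖ₑ := by
  rcases isEmpty_or_nonempty G with hG | hG
  · exact measurable_of_empty _
  obtain ⟨c, hc, hcd⟩ := hs
  have hcne : c.Nonempty := by
    rw [Set.nonempty_iff_ne_empty]
    rintro rfl
    obtain ⟨x⟩ := hG
    have := hcd (Set.mem_range_self x)
    simp at this
  obtain ⟨u, rfl⟩ := hc.exists_eq_range hcne
  choose g hg1 hg2 using fun n => exists_dual_vector'' ℂ (u n)
  have key : ∀ x, ‖f x‖ₑ = ⨆ n, ‖g n (f x)‖ₑ := by
    intro x
    have hle : ∀ n v, ‖g n v‖ ≤ ‖v‖ := fun n v =>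
      ((g n).le_opNorm v).trans (mul_le_of_le_one_left (norm_nonneg _) (hg1 n))
    apply le_antisymm
    · apply ENNReal.le_of_forall_pos_le_add
      intro ε hε _
      obtain ⟨_, ⟨n, rfl⟩, hn⟩ := Metric.mem_closure_iff.1 (hcd (Set.mem_range_self x)) (ε / 2)
        (by positivity)
      refine le_trans ?_ (add_le_add_left (le_iSup (fun n => ‖g n (f x)‖ₑ) n) _)
      rw [← ofReal_norm, ← ofReal_norm, ← ENNReal.ofReal_coe_nnreal,
        ← ENNReal.ofReal_add (norm_nonneg _) ε.coe_nonneg]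
      apply ENNReal.ofReal_le_ofReal
      rw [dist_eq_norm] at hn
      have h1 : ‖f x‖ ≤ ‖f x - u n‖ + ‖u n‖ := by
        simpa using norm_add_le (f x - u n) (u n)
      have h2 : ‖u n‖ = ‖g n (u n)‖ := by rw [hg2 n]; simp
      have h3 : ‖g n (u n)‖ ≤ ‖g n (f x)‖ + ‖g n (f x - u n)‖ := by
        have := norm_sub_le (g n (f x)) (g n (f x - u n))
        simpa using this
      have h4 := hle n (f x - u n)
      linarith
    · refine iSup_le fun n => ?_
      rw [← ofReal_norm, ← ofReal_norm]
      exact ENNReal.ofReal_le_ofReal (hle n _)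
  simp_rw [key]
  exact Measurable.iSup fun n => (hw (g n)).enorm

variable [TopologicalSpace G] [IsTopologicalGroup G] [LocallyCompactSpace G]
  {H : Subgroup G} {hH : IsClosed (H : Set G)}

/-- The functions `f : G → V` that represent the elements of `L_p(π, μ)`: weakly Borel,
`π`-covariant, and with `∫_{G/H} ‖f‖^p dμ` finite. The values are also required to lie in a separable
subspace, which is automatic when `V` is separable, and makes `‖f‖` measurable in general. -/
structure IsLpFunction (M : QuasiInvariantMeasure H hH) (π : H →* (V ≃ₗᵢ[ℂ] V)) (p : ℝ)
    (f : G → V) : Prop where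
  weak_measurable : ∀ φ : StrongDual ℂ V, Measurable fun x => φ (f x)
  separable_range : IsSeparable (Set.range f)
  covariant : ∀ (h : H) (x : G), f ((h : G) * x) = π h (f x)
  lintegral_lt_top : ∫⁻ z, cosetNorm H f z ^ p ∂M.μ < ∞

theorem IsLpFunction.measurable_cosetNorm {M : QuasiInvariantMeasure H hH}
    {π : H →* (V ≃ₗᵢ[ℂ] V)} {p : ℝ} {f : G → V} (hf : IsLpFunction M π p f) :
    Measurable (cosetNorm H f) := by
  apply measurable_from_quotient.2
  have := measurable_enorm_of_weak hf.weak_measurable hf.separable_range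
  convert this using 2 with x
  exact cosetNorm_proj π hf.covariant x

theorem cosetNorm_add_le (f g : G → V) (z : RightCosets H) :
    cosetNorm H (f + g) z ≤ cosetNorm H f z + cosetNorm H g z := enorm_add_le _ _

theorem cosetNorm_smul (c : ℂ) (f : G → V) (z : RightCosets H) :
    cosetNorm H (c • f) z = ‖c‖ₑ * cosetNorm H f z := enorm_smul _ _

/-- The complex vector space of functions representing the elements of `L_p(π, μ)`. -/
def lpFunctions (M : QuasiInvariantMeasure H hH) (π : H →* (V ≃ₗᵢ[ℂ] V)) (p : ℝ) (hp : 1 ≤ p) :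
    Submodule ℂ (G → V) where
  carrier := {f | IsLpFunction M π p f}
  zero_mem' := by
    have hp0 : 0 < p := by linarith
    refine ⟨fun φ => by simp, ?_, fun h x => by simp, ?_⟩
    · refine (Set.countable_singleton (0 : V)).isSeparable.mono ?_
      rintro _ ⟨x, rfl⟩
      rfl
    · simp [cosetNorm, hp0]
  add_mem' := by
    intro f g hf hg
    refine ⟨fun φ => ?_, ?_, fun h x => ?_, ?_⟩
    · have h := (hf.weak_measurable φ).add (hg.weak_measurable φ)
      convert h using 2 with x
      simp
    · refine ((hf.separable_range.prod hg.separable_range).image continuous_add).mono ?_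
      rintro _ ⟨x, rfl⟩
      exact ⟨(f x, g x), ⟨⟨x, rfl⟩, ⟨x, rfl⟩⟩, rfl⟩
    · simp [hf.covariant, hg.covariant]
    · refine lt_of_le_of_lt (lintegral_mono fun z =>
        ENNReal.rpow_le_rpow (cosetNorm_add_le f g z) (by linarith)) ?_
      exact ENNReal.lintegral_rpow_add_lt_top_of_lintegral_rpow_lt_top
        hf.measurable_cosetNorm.aemeasurable hf.lintegral_lt_top hg.lintegral_lt_top hp
  smul_mem' := by
    intro c f hf
    have hp0 : 0 ≤ p := by linarith
    refine ⟨fun φ => ?_, ?_, fun h x => ?_, ?_⟩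
    · simpa using (hf.weak_measurable φ).const_mul c
    · refine (hf.separable_range.image (continuous_const_smul c)).mono ?_
      rintro _ ⟨x, rfl⟩
      exact ⟨f x, ⟨x, rfl⟩, rfl⟩
    · simp [hf.covariant]
    · simp_rw [cosetNorm_smul, ENNReal.mul_rpow_of_nonneg _ _ hp0]
      rw [lintegral_const_mul _ (hf.measurable_cosetNorm.pow_const p)]
      exact ENNReal.mul_lt_top (ENNReal.rpow_lt_top_of_nonneg hp0 (by simp)) hf.lintegral_lt_top

variable {M : QuasiInvariantMeasure H hH} {π : H →* (V ≃ₗᵢ[ℂ] V)} {p : ℝ} {hp : 1 ≤ p}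

/-- The representatives of the elements of `L_p(π, μ)`, as a type of its own (so that it does not
inherit the topology of pointwise convergence). -/
def LpFun (M : QuasiInvariantMeasure H hH) (π : H →* (V ≃ₗᵢ[ℂ] V)) (p : ℝ) (hp : 1 ≤ p) :
    Type _ := lpFunctions M π p hp

noncomputable instance : AddCommGroup (LpFun M π p hp) :=
  inferInstanceAs (AddCommGroup (lpFunctions M π p hp))

noncomputable instance : Module ℂ (LpFun M π p hp) :=
  inferInstanceAs (Module ℂ (lpFunctions M π p hp))

/-- The seminorm `‖f‖_p = (∫_{G/H} ‖f‖^p dμ)^{1/p}`. -/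
noncomputable instance : SeminormedAddCommGroup (LpFun M π p hp) :=
  AddGroupSeminorm.toSeminormedAddCommGroup
    { toFun := fun f => ((∫⁻ z, cosetNorm H f.1 z ^ p ∂M.μ) ^ (1 / p)).toReal
      map_zero' := by
        have hp0 : 0 < p := by linarith
        have h0 : ∀ z, cosetNorm H (0 : LpFun M π p hp).1 z = 0 := fun z => enorm_zero
        simp [h0, hp0]
      add_le' := fun f g => by
        have hp0 : 0 < p := by linarith
        have hfin : ∀ f : LpFun M π p hp,
            (∫⁻ z, cosetNorm H f.1 z ^ p ∂M.μ) ^ (1 / p) ≠ ∞ := fun f =>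
          ENNReal.rpow_ne_top_of_nonneg (by positivity) f.2.lintegral_lt_top.ne
        rw [← ENNReal.toReal_add (hfin f) (hfin g)]
        refine ENNReal.toReal_mono (ENNReal.add_ne_top.2 ⟨hfin f, hfin g⟩) ?_
        refine le_trans ?_ (ENNReal.lintegral_Lp_add_le
          f.2.measurable_cosetNorm.aemeasurable g.2.measurable_cosetNorm.aemeasurable hp)
        refine ENNReal.rpow_le_rpow (lintegral_mono fun z => ?_) (by positivity)
        exact ENNReal.rpow_le_rpow (cosetNorm_add_le f.1 g.1 z) hp0.le
      neg' := fun f => by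
        have h0 : ∀ z, cosetNorm H (-f).1 z = cosetNorm H f.1 z := fun z => enorm_neg _
        simp [h0] }

theorem lpFun_norm_def (f : LpFun M π p hp) :
    ‖f‖ = ((∫⁻ z, cosetNorm H f.1 z ^ p ∂M.μ) ^ (1 / p)).toReal := rfl

noncomputable instance : NormedSpace ℂ (LpFun M π p hp) where
  norm_smul_le c f := by
    have hp0 : 0 < p := by linarith
    rw [lpFun_norm_def, lpFun_norm_def]
    have h1 : ∀ z, cosetNorm H (c • f).1 z = ‖c‖ₑ * cosetNorm H f.1 z :=
      fun z => cosetNorm_smul c f.1 z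
    simp_rw [h1, ENNReal.mul_rpow_of_nonneg _ _ hp0.le]
    rw [lintegral_const_mul _ (f.2.measurable_cosetNorm.pow_const p),
      ENNReal.mul_rpow_of_nonneg _ _ (by positivity), ENNReal.toReal_mul, ← ENNReal.rpow_mul,
      mul_one_div_cancel hp0.ne', ENNReal.rpow_one]
    simp

/-- The normed space `L_p(π, μ)`: functions that are equal almost everywhere, that is, whose
difference has norm zero, are identified. -/
abbrev Lp (M : QuasiInvariantMeasure H hH) (π : H →* (V ≃ₗᵢ[ℂ] V)) (p : ℝ) (hp : 1 ≤ p) : Type _ :=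
  SeparationQuotient (LpFun M π p hp)

variable [BorelSpace G]

theorem measurable_translate (H : Subgroup G) (y : G) : Measurable (translate H y) := by
  apply measurable_from_quotient.2
  exact measurable_quotient_mk''.comp (measurable_mul_const y)

theorem measurable_lam (ρ : RhoFunction H hH) (y : G) : Measurable fun z => ρ.lam z y := by
  apply measurable_from_quotient.2
  exact ((ρ.continuous_rho.comp (continuous_mul_const y)).div ρ.continuous_rho
    fun x => (ρ.rho_pos x).ne').measurable

/-- The operator `(U_y f) (x) = λ(x, y)^{1/p} f (x y)` of the induced representation on
representatives. -/
noncomputable def inducedOp (y : G) (f : LpFun M π p hp) : LpFun M π p hp :=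
  ⟨fun x => ((M.lam (proj H x) y ^ (1 / p) : ℝ) : ℂ) • f.1 (x * y), by
    have hp0 : 0 < p := by linarith
    have hcov : ∀ (h : H) (x : G),
        ((M.lam (proj H ((h : G) * x)) y ^ (1 / p) : ℝ) : ℂ) • f.1 ((h : G) * x * y) =
          π h (((M.lam (proj H x) y ^ (1 / p) : ℝ) : ℂ) • f.1 (x * y)) := fun h x => by
      rw [proj_mul, mul_assoc, f.2.covariant, map_smul]
    have hmeas : Measurable fun x : G => ((M.lam (proj H x) y ^ (1 / p) : ℝ) : ℂ) :=
      Complex.measurable_ofReal.comp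
        (((measurable_lam M.toRhoFunction y).comp measurable_quotient_mk'').pow_const _)
    refine ⟨fun φ => ?_, ?_, hcov, ?_⟩
    · have h := hmeas.mul ((f.2.weak_measurable φ).comp (measurable_mul_const y))
      convert h using 2 with x
      simp
    · refine (((isSeparable_univ_iff.2 inferInstance : IsSeparable (Set.univ : Set ℂ)).prod
        f.2.separable_range).image continuous_smul).mono ?_
      rintro _ ⟨x, rfl⟩
      exact ⟨(_, f.1 (x * y)), ⟨Set.mem_univ _, ⟨x * y, rfl⟩⟩, rfl⟩
    · have h1 : ∀ z : RightCosets H, cosetNorm H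
          (fun x => ((M.lam (proj H x) y ^ (1 / p) : ℝ) : ℂ) • f.1 (x * y)) z ^ p =
          ENNReal.ofReal (M.lam z y) * cosetNorm H f.1 (translate H y z) ^ p := by
        intro z
        obtain ⟨x, rfl⟩ : ∃ x, proj H x = z := ⟨z.out, Quotient.out_eq z⟩
        have hl := M.lam_pos x y
        rw [cosetNorm_proj π hcov, translate_proj, cosetNorm_proj π f.2.covariant, enorm_smul,
          ENNReal.mul_rpow_of_nonneg _ _ hp0.le, ← ofReal_norm, Complex.norm_real,
          Real.norm_of_nonneg (Real.rpow_nonneg hl.le _),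
          ENNReal.ofReal_rpow_of_nonneg (Real.rpow_nonneg hl.le _) hp0.le, ← Real.rpow_mul hl.le,
          one_div_mul_cancel hp0.ne', Real.rpow_one]
      simp_rw [h1]
      have hF := f.2.measurable_cosetNorm.pow_const p
      have h2 := lintegral_withDensity_eq_lintegral_mul M.μ
        (measurable_lam M.toRhoFunction y).ennreal_ofReal (hF.comp (measurable_translate H y))
      simp only [Pi.mul_apply, Function.comp_def] at h2
      have h4 := lintegral_map (μ := M.μ) (hF.comp (measurable_translate H y))
        (measurable_translate H y⁻¹)
      simp only [Function.comp_def] at h4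
      rw [← h2, ← M.map_translate y, h4]
      have h3 : ∀ z : RightCosets H, translate H y (translate H y⁻¹ z) = z := by
        intro z
        obtain ⟨x, rfl⟩ : ∃ x, proj H x = z := ⟨z.out, Quotient.out_eq z⟩
        simp
      simp_rw [h3]
      exact f.2.lintegral_lt_top⟩

end Lp

/-! ### The projective tensor product and the `G`-module tensor product -/

section Tensor

variable (E F : Type*) [SeminormedAddCommGroup E] [NormedSpace ℂ E]
  [SeminormedAddCommGroup F] [NormedSpace ℂ F]

/-- The algebraic tensor product, to be given the greatest cross-norm. -/
def AlgTensor : Type _ := E ⊗[ℂ] F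

noncomputable instance : AddCommGroup (AlgTensor E F) := inferInstanceAs (AddCommGroup (E ⊗[ℂ] F))

noncomputable instance : Module ℂ (AlgTensor E F) := inferInstanceAs (Module ℂ (E ⊗[ℂ] F))

variable {E F}

/-- The elementary tensor `x ⊗ y`. -/
def AlgTensor.tmul (x : E) (y : F) : AlgTensor E F := (x ⊗ₜ[ℂ] y : E ⊗[ℂ] F)

/-- The values `∑ ‖x_i‖ ‖y_i‖` over all finite representations `u = ∑ x_i ⊗ y_i`. -/
def AlgTensor.costs (u : AlgTensor E F) : Set ℝ :=
  {r | ∃ l : List (E × F), u = (l.map fun z => AlgTensor.tmul z.1 z.2).sum ∧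
    r = (l.map fun z => ‖z.1‖ * ‖z.2‖).sum}

theorem AlgTensor.costs_nonneg {u : AlgTensor E F} {r : ℝ} (hr : r ∈ u.costs) : 0 ≤ r := by
  obtain ⟨l, -, rfl⟩ := hr
  apply List.sum_nonneg
  intro a ha
  obtain ⟨z, -, rfl⟩ := List.mem_map.1 ha
  positivity

theorem AlgTensor.costs_bddBelow (u : AlgTensor E F) : BddBelow u.costs :=
  ⟨0, fun _ hr => costs_nonneg hr⟩

theorem AlgTensor.costs_add {u v : AlgTensor E F} {r s : ℝ} (hr : r ∈ u.costs) (hs : s ∈ v.costs) :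
    r + s ∈ (u + v).costs := by
  obtain ⟨l, rfl, rfl⟩ := hr
  obtain ⟨m, rfl, rfl⟩ := hs
  exact ⟨l ++ m, by simp, by simp⟩

theorem AlgTensor.costs_smul (c : ℂ) {u : AlgTensor E F} {r : ℝ} (hr : r ∈ u.costs) :
    ‖c‖ * r ∈ (c • u).costs := by
  obtain ⟨l, rfl, rfl⟩ := hr
  refine ⟨l.map fun z => (c • z.1, z.2), ?_, ?_⟩
  · rw [List.smul_sum, List.map_map, List.map_map]
    rfl
  · rw [← List.sum_map_mul_left, List.map_map]
    congr 1
    apply List.map_congr_left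
    intro z _
    simp [norm_smul, mul_assoc]

theorem AlgTensor.costs_nonempty (u : AlgTensor E F) : u.costs.Nonempty := by
  refine TensorProduct.induction_on (motive := fun u : E ⊗[ℂ] F =>
    (AlgTensor.costs (E := E) (F := F) u).Nonempty) u ?_ ?_ ?_
  · exact ⟨0, [], rfl, by simp⟩
  · intro x y
    exact ⟨_, [(x, y)], (List.sum_singleton (x := AlgTensor.tmul x y)).symm, rfl⟩
  · rintro a b ⟨r, hr⟩ ⟨s, hs⟩
    exact ⟨r + s, costs_add (u := (a : AlgTensor E F)) (v := (b : AlgTensor E F)) hr hs⟩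

/-- The greatest cross-norm (projective norm): the infimum of `∑ ‖x_i‖ ‖y_i‖` over all finite
representations `u = ∑ x_i ⊗ y_i`. -/
noncomputable def AlgTensor.projNorm (u : AlgTensor E F) : ℝ := sInf u.costs

theorem AlgTensor.projNorm_nonneg (u : AlgTensor E F) : 0 ≤ u.projNorm :=
  Real.sInf_nonneg fun _ hr => costs_nonneg hr

theorem AlgTensor.projNorm_smul_le (c : ℂ) (u : AlgTensor E F) :
    (c • u).projNorm ≤ ‖c‖ * u.projNorm := by
  apply le_of_forall_pos_le_add
  intro ε hε
  obtain ⟨r, hr, hlt⟩ := exists_lt_of_csInf_lt u.costs_nonempty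
    (show sInf u.costs < sInf u.costs + ε / (‖c‖ + 1) by
      have : 0 < ε / (‖c‖ + 1) := by positivity
      linarith)
  have h1 : (c • u).projNorm ≤ ‖c‖ * r := csInf_le (costs_bddBelow _) (costs_smul c hr)
  have h2 : ‖c‖ * r ≤ ‖c‖ * (u.projNorm + ε / (‖c‖ + 1)) :=
    mul_le_mul_of_nonneg_left hlt.le (norm_nonneg c)
  have h3 : ‖c‖ * (ε / (‖c‖ + 1)) ≤ ε := by
    have h4 : 0 < ‖c‖ + 1 := by positivity
    rw [mul_div_assoc', div_le_iff₀ h4]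
    nlinarith [norm_nonneg c]
  linarith

noncomputable instance : SeminormedAddCommGroup (AlgTensor E F) :=
  AddGroupSeminorm.toSeminormedAddCommGroup
    { toFun := AlgTensor.projNorm
      map_zero' := le_antisymm
        (csInf_le (AlgTensor.costs_bddBelow _) ⟨[], by simp, by simp⟩) (AlgTensor.projNorm_nonneg _)
      add_le' := fun u v => by
        apply le_of_forall_pos_le_add
        intro ε hε
        obtain ⟨r, hr, hr'⟩ := exists_lt_of_csInf_lt u.costs_nonempty
          (show sInf u.costs < sInf u.costs + ε / 2 by linarith)
        obtain ⟨s, hs, hs'⟩ := exists_lt_of_csInf_lt v.costs_nonempty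
          (show sInf v.costs < sInf v.costs + ε / 2 by linarith)
        have h := csInf_le (AlgTensor.costs_bddBelow _) (AlgTensor.costs_add hr hs)
        simp only [AlgTensor.projNorm] at *
        linarith
      neg' := fun u => by
        have h : ∀ v : AlgTensor E F, (-v).projNorm ≤ v.projNorm := fun v => by
          simpa using AlgTensor.projNorm_smul_le (-1) v
        exact le_antisymm (h u) (by simpa using h (-u)) }

noncomputable instance : NormedSpace ℂ (AlgTensor E F) where
  norm_smul_le := AlgTensor.projNorm_smul_le

variable (E F)

/-- The Banach space projective tensor product `E ⊗^σ F`. -/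
abbrev ProjTensor : Type _ := UniformSpace.Completion (AlgTensor E F)

variable {E F}

/-- The elementary tensor `x ⊗ y` in the projective tensor product. -/
noncomputable def ProjTensor.tmul (x : E) (y : F) : ProjTensor E F :=
  ((AlgTensor.tmul x y : AlgTensor E F) : UniformSpace.Completion (AlgTensor E F))

end Tensor

section Main

variable {G : Type*} [Group G] [TopologicalSpace G] [IsTopologicalGroup G] [LocallyCompactSpace G]
  [MeasurableSpace G] [BorelSpace G]
  {H K : Subgroup G} {hH : IsClosed (H : Set G)} {hK : IsClosed (K : Set G)}
  {V W : Type*} [NormedAddCommGroup V] [NormedSpace ℂ V] [NormedAddCommGroup W] [NormedSpace ℂ W]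

/-- The closed linear span `L` of the elements `U_p^π(s) f ⊗ g - f ⊗ (U_q^γ(s))* g` of
`L_p(π) ⊗^σ L_{q'}(γ*)`, where `1/q + 1/q' = 1`. Under the pairing
`⟨k, g⟩ = ∫_{G/K} ⟨k(x), g(x)⟩ dμ_K(x)` of `L_q(γ)` with `L_{q'}(γ*)`, the adjoint of `U_q^γ(s)` is the
operator `U_{q'}^{γ*}(s⁻¹)`. -/
noncomputable def relations (MH : QuasiInvariantMeasure H hH) (MK : QuasiInvariantMeasure K hK)
    (π : H →* (V ≃ₗᵢ[ℂ] V)) (γ : K →* (W ≃ₗᵢ[ℂ] W)) (p q' : ℝ) (hp : 1 ≤ p) (hq' : 1 ≤ q') :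
    Submodule ℂ (ProjTensor (Lp MH π p hp) (Lp MK (dualRep γ) q' hq')) :=
  (Submodule.span ℂ {u | ∃ (s : G) (f : LpFun MH π p hp)
      (g : LpFun MK (dualRep γ) q' hq'),
    u = ProjTensor.tmul (SeparationQuotient.mk (inducedOp s f)) (SeparationQuotient.mk g) -
      ProjTensor.tmul (SeparationQuotient.mk f)
        (SeparationQuotient.mk (inducedOp s⁻¹ g))}).topologicalClosure

/-- The `G`-module tensor product `L_p(π) ⊗_G^σ L_{q'}(γ*)`. -/
abbrev GTensor (MH : QuasiInvariantMeasure H hH) (MK : QuasiInvariantMeasure K hK)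
    (π : H →* (V ≃ₗᵢ[ℂ] V)) (γ : K →* (W ≃ₗᵢ[ℂ] W)) (p q' : ℝ) (hp : 1 ≤ p) (hq' : 1 ≤ q') :
    Type _ :=
  ProjTensor (Lp MH π p hp) (Lp MK (dualRep γ) q' hq') ⧸ relations MH MK π γ p q' hp hq'

end Main

end InducedTensor

/-! Modulo L, the tensors `f ⊗ g` and `U_s f ⊗ U_s g` agree: apply a defining relation to `f` and
`U_s g`, and use that the adjoint operator undoes `U_s` on the second factor. Hence `n (f ⊗ g)` is
congruent to `T_n = ∑ U_s f ⊗ U_s g` for any choice of `n` group elements `s`.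

Let `f` and `g` be supported in `H F` and `K F` with `F` compact. The separation hypothesis provides
`n` elements for which the translates of `f` have pairwise disjoint supports, and likewise those of
`g`. Averaging over signs, `∑ a_i ⊗ b_i` is the mean of `(∑ ε_i a_i) ⊗ (∑ ε_i b_i)`. By disjointness
and isometry every such product has norm at most `n^{1/p} ‖f‖ · n^{1/q'} ‖g‖`
(`norm_funTmul_add_sum_le`). So `f ⊗ g` lies within `n^{1/p + 1/q' - 1} ‖f‖ ‖g‖` of L. The exponent
is negative and L is closed, so `f ⊗ g` lies in L (`funTmul_mem_relations_of_support`).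

Such functions are dense and elementary tensors span a dense subspace, so L is everything
(`relations_eq_top`). In the lemmas below the exponent `q` plays the role of `q'`. -/

namespace InducedTensor

/-! ### Additivity of the `p`-th power of the norm, and density of compactly supported functions
modulo `H`. -/

section Functions

variable {G : Type*} [Group G] [MeasurableSpace G]
  {V : Type*} [NormedAddCommGroup V] [NormedSpace ℂ V]
  [TopologicalSpace G] [IsTopologicalGroup G] [LocallyCompactSpace G]
  {H : Subgroup G} {hH : IsClosed (H : Set G)}
  {M : QuasiInvariantMeasure H hH} {π : H →* (V ≃ₗᵢ[ℂ] V)} {p : ℝ} {hp : 1 ≤ p}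

/-- The integral `∫_{G/H} ‖f‖^p dμ`, the `p`-th power of the norm. -/
noncomputable def lpMass (f : LpFun M π p hp) : ℝ≥0∞ := ∫⁻ z, cosetNorm H f.1 z ^ p ∂M.μ

theorem norm_eq_lpMass_rpow (f : LpFun M π p hp) : ‖f‖ = (lpMass f).toReal ^ (1 / p) := by
  rw [lpFun_norm_def, ENNReal.toReal_rpow]
  rfl

/-- The `p`-th power of the norm is additive on functions with disjoint supports. -/
theorem lpMass_add_of_disjoint {f g : LpFun M π p hp} (h : ∀ x, f.1 x = 0 ∨ g.1 x = 0) :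
    lpMass (f + g) = lpMass f + lpMass g := by
  have hp0 : 0 < p := by linarith
  unfold lpMass
  rw [← lintegral_add_left (f.2.measurable_cosetNorm.pow_const p)]
  refine lintegral_congr fun z => ?_
  change ‖f.1 z.out + g.1 z.out‖ₑ ^ p = ‖f.1 z.out‖ₑ ^ p + ‖g.1 z.out‖ₑ ^ p
  rcases h z.out with h | h <;> simp [h, hp0]

theorem lpMass_zero : lpMass (0 : LpFun M π p hp) = 0 := by
  have hp0 : 0 < p := by linarith
  have h : ∀ z, cosetNorm H (0 : LpFun M π p hp).1 z = 0 := fun z => enorm_zero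
  simp [lpMass, h, hp0]

theorem lpMass_neg (f : LpFun M π p hp) : lpMass (-f) = lpMass f :=
  lintegral_congr fun z => congrArg (· ^ p) (enorm_neg (f.1 z.out))

theorem lpMass_sub_of_disjoint {f g : LpFun M π p hp} (h : ∀ x, f.1 x = 0 ∨ g.1 x = 0) :
    lpMass (f - g) = lpMass f + lpMass g := by
  rw [sub_eq_add_neg, lpMass_add_of_disjoint, lpMass_neg]
  intro x
  exact (h x).imp_right fun hx => neg_eq_zero.2 hx

/-- Multiplication of a covariant function by the indicator function of the set `H F`. -/
noncomputable def cutoff (f : LpFun M π p hp) (F : Set G)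
    (hF : MeasurableSet ((H : Set G) * F)) : LpFun M π p hp :=
  ⟨((H : Set G) * F).indicator f.1, by
    have hp0 : 0 < p := by linarith
    have hmem : ∀ (h : H) (x : G), (h : G) * x ∈ (H : Set G) * F ↔ x ∈ (H : Set G) * F := by
      intro h x
      constructor
      · rintro ⟨k, hk, y, hy, hxy⟩
        refine ⟨(h : G)⁻¹ * k, H.mul_mem (H.inv_mem h.2) hk, y, hy, ?_⟩
        change k * y = _ at hxy
        change (h : G)⁻¹ * k * y = x
        rw [mul_assoc, hxy, inv_mul_cancel_left]
      · rintro ⟨k, hk, y, hy, rfl⟩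
        exact ⟨(h : G) * k, H.mul_mem h.2 hk, y, hy, mul_assoc _ _ _⟩
    refine ⟨fun φ => ?_, ?_, fun h x => ?_, ?_⟩
    · convert (f.2.weak_measurable φ).indicator hF using 2 with x
      by_cases hx : x ∈ (H : Set G) * F <;> simp [hx]
    · refine (f.2.separable_range.union (Set.countable_singleton (0 : V)).isSeparable).mono ?_
      rintro _ ⟨x, rfl⟩
      by_cases hx : x ∈ (H : Set G) * F <;> simp [hx]
    · by_cases hx : x ∈ (H : Set G) * F
      · rw [Set.indicator_of_mem hx, Set.indicator_of_mem ((hmem h x).2 hx), f.2.covariant]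
      · rw [Set.indicator_of_notMem hx, Set.indicator_of_notMem (mt (hmem h x).1 hx), map_zero]
    · refine lt_of_le_of_lt (lintegral_mono fun z => ENNReal.rpow_le_rpow ?_ hp0.le)
        f.2.lintegral_lt_top
      exact enorm_indicator_le_enorm_self _ _⟩

/-- The functions supported in some `H F` with `F` compact are dense in `L_p`. -/
theorem exists_compact_support_norm_sub_lt [BorelSpace G] [SigmaCompactSpace G]
    (f : LpFun M π p hp) {ε : ℝ} (hε : 0 < ε) :
    ∃ (F : Set G) (f' : LpFun M π p hp), IsCompact F ∧ (∀ x ∉ (H : Set G) * F, f'.1 x = 0) ∧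
      ‖f - f'‖ < ε := by
  have hp0 : 0 < p := by linarith
  have hF : ∀ n, MeasurableSet ((H : Set G) * compactCovering G n) := fun n =>
    (hH.mul_right_of_isCompact (isCompact_compactCovering G n)).measurableSet
  -- Dominated convergence with dominating function `‖f‖^p`: the representative of each coset
  -- eventually enters the compact exhaustion, and from then on the difference vanishes there.
  have hlim : Filter.Tendsto (fun n => lpMass (f - cutoff f _ (hF n))) Filter.atTop
      (nhds (∫⁻ _, 0 ∂M.μ)) := by
    refine tendsto_lintegral_of_dominated_convergence (fun z => cosetNorm H f.1 z ^ p)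
      (fun n => (f - cutoff f _ (hF n)).2.measurable_cosetNorm.pow_const p)
      (fun n => Filter.Eventually.of_forall fun z => ?_) f.2.lintegral_lt_top.ne
      (Filter.Eventually.of_forall fun z => ?_)
    · refine ENNReal.rpow_le_rpow ?_ hp0.le
      change ‖f.1 z.out - ((H : Set G) * compactCovering G n).indicator f.1 z.out‖ₑ ≤ ‖f.1 z.out‖ₑ
      by_cases hx : z.out ∈ (H : Set G) * compactCovering G n <;> simp [hx]
    · obtain ⟨n, hn⟩ := exists_mem_compactCovering z.out
      refine tendsto_const_nhds.congr' ?_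
      filter_upwards [Filter.eventually_ge_atTop n] with m hm
      have hx : z.out ∈ (H : Set G) * compactCovering G m :=
        ⟨1, H.one_mem, z.out, compactCovering_subset G hm hn, one_mul _⟩
      change 0 = ‖f.1 z.out - ((H : Set G) * compactCovering G m).indicator f.1 z.out‖ₑ ^ p
      simp [hx, hp0]
  rw [lintegral_zero] at hlim
  have hnorm : Filter.Tendsto (fun n => ‖f - cutoff f _ (hF n)‖) Filter.atTop (nhds 0) := by
    simp_rw [norm_eq_lpMass_rpow]
    have h := ((ENNReal.tendsto_toReal ENNReal.zero_ne_top).comp hlim).rpow_const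
      (p := 1 / p) (Or.inr (by positivity))
    simpa [hp0.ne'] using h
  obtain ⟨n, hn⟩ := (hnorm.eventually (gt_mem_nhds hε)).exists
  exact ⟨_, cutoff f _ (hF n), isCompact_compactCovering G n,
    fun x hx => Set.indicator_of_notMem hx _, hn⟩

/-! ### The induced operators: inverses, isometry, supports. -/

variable [BorelSpace G]

theorem inducedOp_apply (y : G) (f : LpFun M π p hp) (x : G) :
    (inducedOp y f).1 x = ((M.lam (proj H x) y ^ (1 / p) : ℝ) : ℂ) • f.1 (x * y) := rfl

/-- The cocycle identity `λ(x, s⁻¹) λ(x s⁻¹, s) = 1` makes the scalar factors cancel. -/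
theorem inducedOp_inv_inducedOp (s : G) (f : LpFun M π p hp) :
    inducedOp s⁻¹ (inducedOp s f) = f := by
  refine Subtype.ext (funext fun x => ?_)
  have h1 := M.rho_pos x
  have h2 := M.rho_pos (x * s⁻¹)
  rw [inducedOp_apply, inducedOp_apply, smul_smul, ← Complex.ofReal_mul,
    ← Real.mul_rpow (M.lam_pos _ _).le (M.lam_pos _ _).le, RhoFunction.lam_proj,
    RhoFunction.lam_proj, inv_mul_cancel_right, div_mul_div_cancel₀ h1.ne', div_self h2.ne']
  simp

/-- The operators of the induced representation are isometries. -/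
theorem lpMass_inducedOp (y : G) (f : LpFun M π p hp) : lpMass (inducedOp y f) = lpMass f := by
  have hp0 : 0 < p := by linarith
  have h1 : ∀ z : RightCosets H, cosetNorm H (inducedOp y f).1 z ^ p =
      ENNReal.ofReal (M.lam z y) * cosetNorm H f.1 (translate H y z) ^ p := by
    intro z
    obtain ⟨x, rfl⟩ : ∃ x, proj H x = z := ⟨z.out, Quotient.out_eq z⟩
    have hl := M.lam_pos x y
    rw [cosetNorm_proj π (inducedOp y f).2.covariant, translate_proj,
      cosetNorm_proj π f.2.covariant, inducedOp_apply, enorm_smul,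
      ENNReal.mul_rpow_of_nonneg _ _ hp0.le, ← ofReal_norm, Complex.norm_real,
      Real.norm_of_nonneg (Real.rpow_nonneg hl.le _),
      ENNReal.ofReal_rpow_of_nonneg (Real.rpow_nonneg hl.le _) hp0.le, ← Real.rpow_mul hl.le,
      one_div_mul_cancel hp0.ne', Real.rpow_one]
  have hF := f.2.measurable_cosetNorm.pow_const p
  have h2 := lintegral_withDensity_eq_lintegral_mul M.μ
    (measurable_lam M.toRhoFunction y).ennreal_ofReal (hF.comp (measurable_translate H y))
  have h3 := lintegral_map (μ := M.μ) (hF.comp (measurable_translate H y))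
    (measurable_translate H y⁻¹)
  simp only [Pi.mul_apply, Function.comp_def] at h2 h3
  have h4 : ∀ z : RightCosets H, translate H y (translate H y⁻¹ z) = z := by
    intro z
    obtain ⟨x, rfl⟩ : ∃ x, proj H x = z := ⟨z.out, Quotient.out_eq z⟩
    simp
  simp_rw [lpMass, h1]
  -- Quasi-invariance turns the density `λ(·, y)` into the push-forward under translation by `y⁻¹`,
  -- which then cancels the translation by `y` in the integrand.
  rw [← h2, ← M.map_translate y, h3]
  simp_rw [h4]

/-- If `f` is supported in `A` then `U_s f` is supported in `A s⁻¹`. -/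
theorem inducedOp_eq_zero {A : Set G} {f : LpFun M π p hp} (hf : ∀ x ∉ A, f.1 x = 0) {s x : G}
    (hx : x ∉ A * {s⁻¹}) : (inducedOp s f).1 x = 0 := by
  rw [inducedOp_apply, hf, smul_zero]
  exact fun h => hx ⟨x * s, h, s⁻¹, rfl, mul_inv_cancel_right x s⟩

theorem inducedOp_disjoint {A : Set G} {f : LpFun M π p hp} (hf : ∀ x ∉ A, f.1 x = 0) {s t : G}
    (hst : Disjoint (A * {s⁻¹}) (A * {t⁻¹})) (x : G) :
    (inducedOp s f).1 x = 0 ∨ (inducedOp t f).1 x = 0 := by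
  by_cases hx : x ∈ A * {s⁻¹}
  · exact Or.inr (inducedOp_eq_zero hf (Set.disjoint_left.1 hst hx))
  · exact Or.inl (inducedOp_eq_zero hf hx)

end Functions

/-! ### Elementary tensors in the projective tensor product. -/

section Tensor

variable {E F : Type*} [SeminormedAddCommGroup E] [NormedSpace ℂ E]
  [SeminormedAddCommGroup F] [NormedSpace ℂ F]

/-- The canonical bilinear map into the projective tensor product. -/
noncomputable def ProjTensor.mkBilin : E →ₗ[ℂ] F →ₗ[ℂ] ProjTensor E F :=
  (TensorProduct.mk ℂ E F).compr₂
    (UniformSpace.Completion.toComplL (𝕜 := ℂ) (E := AlgTensor E F)).toLinearMap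

theorem ProjTensor.mkBilin_apply (x : E) (y : F) : ProjTensor.mkBilin x y = ProjTensor.tmul x y :=
  rfl

theorem ProjTensor.norm_tmul_le (x : E) (y : F) : ‖ProjTensor.tmul x y‖ ≤ ‖x‖ * ‖y‖ := by
  rw [ProjTensor.tmul, UniformSpace.Completion.norm_coe]
  exact csInf_le (AlgTensor.costs_bddBelow _) ⟨[(x, y)], by simp, by simp⟩

/-- A closed subspace containing all elementary tensors is everything. -/
theorem ProjTensor.eq_top_of_tmul_mem {S : Submodule ℂ (ProjTensor E F)}
    (hS : IsClosed (S : Set (ProjTensor E F))) (h : ∀ x y, ProjTensor.tmul x y ∈ S) : S = ⊤ := by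
  rw [eq_top_iff]
  rintro u -
  refine UniformSpace.Completion.induction_on u hS fun a => ?_
  refine TensorProduct.induction_on (motive := fun a : E ⊗[ℂ] F =>
    UniformSpace.Completion.coe' (α := AlgTensor E F) a ∈ S) a ?_ h ?_
  · exact S.zero_mem
  · intro a b ha hb
    have h := UniformSpace.Completion.coe_add (α := AlgTensor E F) a b
    exact Set.mem_of_eq_of_mem h (S.add_mem ha hb)

/-- One step of the sign averaging: the cross terms `a ⊗ d` and `c ⊗ b` cancel. The spectator `r`
carries the terms whose signs are yet to be averaged, so that they stay inside the norm. -/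
theorem ProjTensor.add_tmul_add_add_sub_tmul_sub (a c : E) (b d : F) (r : ProjTensor E F) :
    ProjTensor.tmul a b + (ProjTensor.tmul c d + r) =
      (1 / 2 : ℂ) • ((ProjTensor.tmul (a + c) (b + d) + r) +
        (ProjTensor.tmul (a - c) (b - d) + r)) := by
  simp only [← ProjTensor.mkBilin_apply, map_add, map_sub, LinearMap.add_apply,
    LinearMap.sub_apply]
  module

end Tensor

theorem tendsto_of_norm_sub_lt {X : Type*} [SeminormedAddCommGroup X] {a : X} {u : ℕ → X}
    (h : ∀ n : ℕ, ‖a - u n‖ < 1 / ((n : ℝ) + 1)) : Filter.Tendsto u Filter.atTop (nhds a) := by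
  rw [tendsto_iff_norm_sub_tendsto_zero]
  refine squeeze_zero (fun n => norm_nonneg _) (fun n => ?_)
    (tendsto_one_div_add_atTop_nhds_zero_nat (𝕜 := ℝ))
  rw [norm_sub_rev]
  exact (h n).le

/-! ### Disjoint translates from the separation hypothesis. -/

/-- Finitely many translates of the sets `A * F` and `B * F` can be made pairwise disjoint. -/
theorem exists_pairwise_disjoint_translates {G : Type*} [Group G] [TopologicalSpace G]
    [IsTopologicalGroup G] {A B : Set G}
    (hsep : ∀ F : Set G, IsCompact F → ∃ x : G,
      Disjoint (A * F * {x}) (A * F) ∧ Disjoint (B * F * {x}) (B * F))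
    {F : Set G} (hF : IsCompact F) (n : ℕ) :
    ∃ l : List G, l.length = n ∧ l.Pairwise fun s t =>
      Disjoint (A * F * {s⁻¹}) (A * F * {t⁻¹}) ∧ Disjoint (B * F * {s⁻¹}) (B * F * {t⁻¹}) := by
  induction n with
  | zero => exact ⟨[], rfl, List.Pairwise.nil⟩
  | succ n ih =>
    obtain ⟨l, hl, hpair⟩ := ih
    have hfin : {t : G | t ∈ l}.Finite := l.finite_toSet
    -- This compact set contains `F` and every earlier `F t⁻¹`, so a single `x` moves `A F` and `B
    -- F` off all the earlier translates at once. The new element is `x⁻¹` because `U_s` moves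
    -- supports by `s⁻¹`.
    obtain ⟨x, hxA, hxB⟩ := hsep (F ∪ F * (fun t : G => t⁻¹) '' {t | t ∈ l})
      (hF.union (hF.mul (hfin.image _).isCompact))
    refine ⟨x⁻¹ :: l, by simp [hl], List.pairwise_cons.2 ⟨fun t ht => ?_, hpair⟩⟩
    have hsub : ∀ C : Set G, C * F * {t⁻¹} ⊆ C * (F ∪ F * (fun t : G => t⁻¹) '' {t | t ∈ l}) := by
      intro C
      rw [mul_assoc]
      refine Set.mul_subset_mul_left (Set.subset_union_of_subset_right ?_ _)
      exact Set.mul_subset_mul_left (Set.singleton_subset_iff.2 ⟨t, ht, rfl⟩)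
    have hsub' : ∀ C : Set G, C * F * {(x⁻¹)⁻¹} ⊆
        C * (F ∪ F * (fun t : G => t⁻¹) '' {t | t ∈ l}) * {x} := by
      intro C
      rw [inv_inv]
      exact Set.mul_subset_mul_right (Set.mul_subset_mul_left Set.subset_union_left)
    exact ⟨hxA.mono (hsub' A) (hsub A), hxB.mono (hsub' B) (hsub B)⟩

/-! ### The sign-averaging estimate. -/

section Main

variable {G : Type*} [Group G] [TopologicalSpace G] [IsTopologicalGroup G] [LocallyCompactSpace G]
  [MeasurableSpace G] [BorelSpace G]
  {H K : Subgroup G} {hH : IsClosed (H : Set G)} {hK : IsClosed (K : Set G)}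
  {V W : Type*} [NormedAddCommGroup V] [NormedSpace ℂ V] [NormedAddCommGroup W] [NormedSpace ℂ W]
  {MH : QuasiInvariantMeasure H hH} {MK : QuasiInvariantMeasure K hK}
  {π : H →* (V ≃ₗᵢ[ℂ] V)} {p q : ℝ} {hp : 1 ≤ p} {hq : 1 ≤ q}

/-- The elementary tensor of the classes of two functions. -/
noncomputable def funTmul {σ : K →* (W ≃ₗᵢ[ℂ] W)} (f : LpFun MH π p hp) (g : LpFun MK σ q hq) :
    ProjTensor (Lp MH π p hp) (Lp MK σ q hq) :=
  ProjTensor.tmul (SeparationQuotient.mk f) (SeparationQuotient.mk g)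

/-- Averaging over signs bounds the projective norm of a sum of elementary tensors of translates
with disjoint supports. -/
theorem norm_funTmul_add_sum_le {σ : K →* (W ≃ₗᵢ[ℂ] W)} (f : LpFun MH π p hp)
    (g : LpFun MK σ q hq) (l : List G)
    (hl : l.Pairwise fun s t => (∀ x, (inducedOp s f).1 x = 0 ∨ (inducedOp t f).1 x = 0) ∧
      ∀ x, (inducedOp s g).1 x = 0 ∨ (inducedOp t g).1 x = 0)
    (a : LpFun MH π p hp) (b : LpFun MK σ q hq)
    (ha : ∀ s ∈ l, ∀ x, a.1 x = 0 ∨ (inducedOp s f).1 x = 0)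
    (hb : ∀ s ∈ l, ∀ x, b.1 x = 0 ∨ (inducedOp s g).1 x = 0) :
    ‖funTmul a b + (l.map fun s => funTmul (inducedOp s f) (inducedOp s g)).sum‖ ≤
      (lpMass a + l.length * lpMass f).toReal ^ (1 / p) *
        (lpMass b + l.length * lpMass g).toReal ^ (1 / q) := by
  -- The pair `a`, `b` accumulates the partial signed sums `∑ ε_i U_{s_i} f` and `∑ ε_i U_{s_i} g`,
  -- with the same signs in both. Each step branches on the sign of the next term; both branches
  -- give the same bound, since mass is blind to signs on disjoint supports.
  induction l generalizing a b with
  | nil =>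
    simpa [funTmul, norm_eq_lpMass_rpow] using
      ProjTensor.norm_tmul_le (SeparationQuotient.mk a) (SeparationQuotient.mk b)
  | cons s l ih =>
    obtain ⟨hs, hl⟩ := List.pairwise_cons.1 hl
    have has := ha s List.mem_cons_self
    have hbs := hb s List.mem_cons_self
    have h1 := ih hl (a + inducedOp s f) (b + inducedOp s g)
      (fun t ht x => by
        rcases ha t (List.mem_cons_of_mem _ ht) x with h | h
        · rcases (hs t ht).1 x with h' | h'
          · exact Or.inl (by change a.1 x + (inducedOp s f).1 x = 0; rw [h, h', add_zero])
          · exact Or.inr h'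
        · exact Or.inr h)
      (fun t ht x => by
        rcases hb t (List.mem_cons_of_mem _ ht) x with h | h
        · rcases (hs t ht).2 x with h' | h'
          · exact Or.inl (by change b.1 x + (inducedOp s g).1 x = 0; rw [h, h', add_zero])
          · exact Or.inr h'
        · exact Or.inr h)
    have h2 := ih hl (a - inducedOp s f) (b - inducedOp s g)
      (fun t ht x => by
        rcases ha t (List.mem_cons_of_mem _ ht) x with h | h
        · rcases (hs t ht).1 x with h' | h'
          · exact Or.inl (by change a.1 x - (inducedOp s f).1 x = 0; rw [h, h', sub_zero])
          · exact Or.inr h'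
        · exact Or.inr h)
      (fun t ht x => by
        rcases hb t (List.mem_cons_of_mem _ ht) x with h | h
        · rcases (hs t ht).2 x with h' | h'
          · exact Or.inl (by change b.1 x - (inducedOp s g).1 x = 0; rw [h, h', sub_zero])
          · exact Or.inr h'
        · exact Or.inr h)
    rw [lpMass_add_of_disjoint has, lpMass_add_of_disjoint hbs, lpMass_inducedOp,
      lpMass_inducedOp] at h1
    rw [lpMass_sub_of_disjoint has, lpMass_sub_of_disjoint hbs, lpMass_inducedOp,
      lpMass_inducedOp] at h2
    have hlen : ∀ m n : ℝ≥0∞, m + ((s :: l).length : ℝ≥0∞) * n = m + n + l.length * n := by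
      intro m n
      push_cast [List.length_cons]
      ring
    rw [hlen, hlen, List.map_cons, List.sum_cons]
    unfold funTmul at h1 h2 ⊢
    rw [ProjTensor.add_tmul_add_add_sub_tmul_sub, norm_smul]
    refine (mul_le_mul_of_nonneg_left ((norm_add_le _ _).trans (add_le_add h1 h2))
      (norm_nonneg _)).trans_eq ?_
    norm_num
    ring

/-! ### The closed span of the relations is the whole space. -/

variable {γ : K →* (W ≃ₗᵢ[ℂ] W)}

theorem funTmul_sub_funTmul_inducedOp_mem (f : LpFun MH π p hp)
    (g : LpFun MK (dualRep γ) q hq) (s : G) :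
    funTmul (inducedOp s f) (inducedOp s g) - funTmul f g ∈ relations MH MK π γ p q hp hq := by
  refine Submodule.le_topologicalClosure _ (Submodule.subset_span ⟨s, f, inducedOp s g, ?_⟩)
  rw [inducedOp_inv_inducedOp]
  rfl

theorem isClosed_relations : IsClosed (relations MH MK π γ p q hp hq :
    Set (ProjTensor (Lp MH π p hp) (Lp MK (dualRep γ) q hq))) :=
  Submodule.isClosed_topologicalClosure _

theorem funTmul_mem_relations_of_support (hpq : 1 / p + 1 / q < 1)
    (hsep : ∀ F : Set G, IsCompact F → ∃ x : G,
      Disjoint ((H : Set G) * F * {x}) ((H : Set G) * F) ∧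
        Disjoint ((K : Set G) * F * {x}) ((K : Set G) * F))
    {F : Set G} (hF : IsCompact F) {f : LpFun MH π p hp} {g : LpFun MK (dualRep γ) q hq}
    (hf : ∀ x ∉ (H : Set G) * F, f.1 x = 0) (hg : ∀ x ∉ (K : Set G) * F, g.1 x = 0) :
    funTmul f g ∈ relations MH MK π γ p q hp hq := by
  have hp0 : 0 < p := by linarith
  have hq0 : 0 < q := by linarith
  choose l hlen hl using exists_pairwise_disjoint_translates hsep hF
  set T : ℕ → ProjTensor (Lp MH π p hp) (Lp MK (dualRep γ) q hq) := fun n =>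
    ((l n).map fun s => funTmul (inducedOp s f) (inducedOp s g)).sum with hT
  have hnorm : ∀ n, ‖T n‖ ≤ (n : ℝ) ^ (1 / p + 1 / q) * (‖f‖ * ‖g‖) := by
    intro n
    have h := norm_funTmul_add_sum_le f g (l n)
      ((hl n).imp fun h => ⟨inducedOp_disjoint hf h.1, inducedOp_disjoint hg h.2⟩) 0 0
      (fun _ _ _ => Or.inl rfl) (fun _ _ _ => Or.inl rfl)
    have h0 : funTmul (0 : LpFun MH π p hp) (0 : LpFun MK (dualRep γ) q hq) = 0 := by
      rw [funTmul, ← ProjTensor.mkBilin_apply, SeparationQuotient.mk_zero, map_zero,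
        LinearMap.zero_apply]
    rw [h0, lpMass_zero, lpMass_zero, zero_add, zero_add, zero_add, hlen, ENNReal.toReal_mul, ENNReal.toReal_mul,
      ENNReal.toReal_natCast, Real.mul_rpow (by positivity) (by positivity),
      Real.mul_rpow (by positivity) (by positivity), ← norm_eq_lpMass_rpow,
      ← norm_eq_lpMass_rpow] at h
    rw [Real.rpow_add_of_nonneg (by positivity) (by positivity) (by positivity)]
    exact h.trans_eq (by ring)
  have hmem : ∀ n, T n - (n : ℂ) • funTmul f g ∈ relations MH MK π γ p q hp hq := by
    intro n
    have : ∀ l : List G, (l.map fun s => funTmul (inducedOp s f) (inducedOp s g)).sum -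
        (l.length : ℂ) • funTmul f g ∈ relations MH MK π γ p q hp hq := by
      intro l
      induction l with
      | nil => simp
      | cons s l ih =>
        have h := add_mem (funTmul_sub_funTmul_inducedOp_mem f g s) ih
        convert h using 1
        push_cast [List.length_cons, List.map_cons, List.sum_cons]
        module
    simpa only [hlen] using this (l n)
  have hlim : Filter.Tendsto (fun n : ℕ => (n : ℂ)⁻¹ • T n) Filter.atTop (nhds 0) := by
    have h1 : Filter.Tendsto (fun n : ℕ => (n : ℝ) ^ (-(1 - (1 / p + 1 / q))) * (‖f‖ * ‖g‖))
        Filter.atTop (nhds 0) := by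
      simpa using ((tendsto_rpow_neg_atTop (sub_pos.2 hpq)).comp
        tendsto_natCast_atTop_atTop).mul_const (‖f‖ * ‖g‖)
    refine squeeze_zero_norm' ?_ h1
    filter_upwards [Filter.eventually_gt_atTop 0] with n hn
    have hn' : (0 : ℝ) < n := Nat.cast_pos.2 hn
    rw [norm_smul, norm_inv, Complex.norm_natCast, neg_sub, Real.rpow_sub_one hn'.ne']
    refine (mul_le_mul_of_nonneg_left (hnorm n) (by positivity)).trans_eq ?_
    ring
  -- For `n > 0` this element of L equals `f ⊗ g - T_n / n`, and `T_n / n` tends to zero.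
  have hlim' : Filter.Tendsto (fun n : ℕ => -((n : ℂ)⁻¹ • (T n - (n : ℂ) • funTmul f g)))
      Filter.atTop (nhds (funTmul f g)) := by
    have h := hlim.const_sub (funTmul f g)
    rw [sub_zero] at h
    refine h.congr' ?_
    filter_upwards [Filter.eventually_gt_atTop 0] with n hn
    have hn' : (n : ℂ) ≠ 0 := Nat.cast_ne_zero.2 hn.ne'
    rw [smul_sub, inv_smul_smul₀ hn', neg_sub]
  exact isClosed_relations.mem_of_tendsto hlim'
    (Filter.Eventually.of_forall fun n => neg_mem (Submodule.smul_mem _ _ (hmem n)))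

theorem relations_eq_top [SigmaCompactSpace G] (hpq : 1 / p + 1 / q < 1)
    (hsep : ∀ F : Set G, IsCompact F → ∃ x : G,
      Disjoint ((H : Set G) * F * {x}) ((H : Set G) * F) ∧
        Disjoint ((K : Set G) * F * {x}) ((K : Set G) * F)) :
    relations MH MK π γ p q hp hq = ⊤ := by
  refine ProjTensor.eq_top_of_tmul_mem isClosed_relations fun x y => ?_
  obtain ⟨f, rfl⟩ := SeparationQuotient.surjective_mk x
  obtain ⟨g, rfl⟩ := SeparationQuotient.surjective_mk y
  choose A f' hA hf' hf using fun n : ℕ =>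
    exists_compact_support_norm_sub_lt f (Nat.one_div_pos_of_nat (α := ℝ) (n := n))
  choose B g' hB hg' hg using fun n : ℕ =>
    exists_compact_support_norm_sub_lt g (Nat.one_div_pos_of_nat (α := ℝ) (n := n))
  -- Both approximants must be moved by the same group elements, hence the common compact set `A n ∪
  -- B n`.
  have hmem : ∀ n, funTmul (f' n) (g' n) ∈ relations MH MK π γ p q hp hq := fun n =>
    funTmul_mem_relations_of_support hpq hsep ((hA n).union (hB n))
      (fun x hx => hf' n x fun h => hx (Set.mul_subset_mul_left Set.subset_union_left h))
      (fun x hx => hg' n x fun h => hx (Set.mul_subset_mul_left Set.subset_union_right h))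
  have hcont : Continuous fun z : Lp MH π p hp × Lp MK (dualRep γ) q hq =>
      ProjTensor.tmul z.1 z.2 :=
    (ProjTensor.mkBilin.mkContinuous₂ 1 fun x y => by
      simpa [ProjTensor.mkBilin_apply] using ProjTensor.norm_tmul_le x y).continuous₂
  have h1 := (SeparationQuotient.continuous_mk.tendsto f).comp (tendsto_of_norm_sub_lt hf)
  have h2 := (SeparationQuotient.continuous_mk.tendsto g).comp (tendsto_of_norm_sub_lt hg)
  exact isClosed_relations.mem_of_tendsto ((hcont.tendsto _).comp (h1.prodMk_nhds h2))
    (Filter.Eventually.of_forall hmem)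

end Main

end InducedTensor

theorem theorem5p1
    {G : Type*} [Group G] [TopologicalSpace G] [IsTopologicalGroup G] [LocallyCompactSpace G]
    [T2Space G] [SecondCountableTopology G] [MeasurableSpace G] [BorelSpace G]
    (H K : Subgroup G) (hH : IsClosed (H : Set G)) (hK : IsClosed (K : Set G))
    {V W : Type*} [NormedAddCommGroup V] [NormedSpace ℂ V] [CompleteSpace V]
    [NormedAddCommGroup W] [NormedSpace ℂ W] [CompleteSpace W]
    (π : H →* (V ≃ₗᵢ[ℂ] V)) (hπ : ∀ v : V, Continuous fun h : H => π h v)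
    (γ : K →* (W ≃ₗᵢ[ℂ] W)) (hγ : ∀ w : W, Continuous fun k : K => γ k w)
    (MH : InducedTensor.QuasiInvariantMeasure H hH)
    (MK : InducedTensor.QuasiInvariantMeasure K hK)
    (p q' : ℝ) (hp : 1 < p) (hq' : 1 < q') (hpq : 1 / p + 1 / q' < 1)
    (hsep : ∀ F : Set G, IsCompact F → ∃ x : G,
      Disjoint ((H : Set G) * F * {x}) ((H : Set G) * F) ∧
        Disjoint ((K : Set G) * F * {x}) ((K : Set G) * F)) :
    ∀ u : InducedTensor.GTensor MH MK π γ p q' hp.le hq'.le, u = 0 := by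
  intro u
  obtain ⟨v, rfl⟩ := Submodule.Quotient.mk_surjective _ u
  rw [Submodule.Quotient.mk_eq_zero, InducedTensor.relations_eq_top hpq hsep]
  exact Submodule.mem_top
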